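/- For $n\ge 1$ let $N=2^n$, index $[N]$ by $\{0,1\}^n$, let $H_N$ be the normalized Hadamard matrix, $(H_N)_{x,y}=(-1)^{x\cdot y}/\sqrt N$, and for $f:\{0,1\}^n\to\{\pm1\}$ let $\hat f(x)=\frac1N\sum_y f(y)(-1)^{x\cdot y}$. Let $C\ge 20$ be a constant and $\varepsilon=1/(C\ln N)$. Let $\mathcal D$ be the following distribution over pairs $(f,g)$ of functions $\{0,1\}^n\to\{\pm1\}$. Draw $X\in\mathbb R^N$ with independent $\mathcal N(0,\varepsilon)$ coordinates (variance $\varepsilon$), let $Y=H_NX$, and let $z=(X,Y^2-\varepsilon)\in\mathbb R^{2N}$, where the square is taken coordinatewise. Independently for each coordinate, round $z_i$ to $1$ with probability $\frac{1+\operatorname{trnc}(z_i)}2$ and to $-1$ with probability $\frac{1-\operatorname{trnc}(z_i)}2$, where $\operatorname{trnc}(a)=\min(1,\max(-1,a))$. The first $N$ rounded values are $f$, the last $N$ are $g$. Under $\mathcal D$ the function $f$ is uniformly distributed; let $\mathcal D_f$ be the conditional distribution of $g$ given $f$. Let $\mathcal R_f$ be the following random element of $\{0,1\}^n$: sample $g\sim\mathcal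 D_f$; then make up to $4n^2$ attempts, each of which draws a fresh uniform $x\in\{0,1\}^n$ and outputs it (and stops) if $g(x)=1$; if all attempts fail, output a uniformly random element. Let $\mathcal C_f$ be the Fourier distribution of $f$, which outputs $x$ with probability $\hat f(x)^2$. **Claim.** For every constant $C\ge 20$ there is $n_0$ (depending only on $C$) such that for all $n\ge n_0$, with $f:\{0,1\}^n\to\{\pm1\}$ uniformly random, $$\mathop{\mathbf E}_{f,\;x\sim\mathcal C_f}\Big[\Pr[\mathcal R_f\text{ samples }x]\Big]\;\ge\;\frac{1+\varepsilon^2/8}{N}.$$ Consequently the sampler $f\mapsto\mathcal C_f$ solves $\mathsf{RHOG}$: there are $c>0$ and $k\in\mathbb N$ such that for all sufficiently large $n$ this expectation is at least $b/N$ with $b=1+c\,n^{-k}$. -/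

import Mathlib

open MeasureTheory ProbabilityTheory Filter
open scoped ENNReal NNReal BigOperators

namespace RHOG

/-! ### Boolean functions and their Fourier coefficients -/

/-- The Boolean cube `{0,1}^n`; it also serves as the index set `[N]`, where `N = 2^n`. -/
abbrev Cube (n : ℕ) : Type := Fin n → Bool

/-- Boolean functions `{0,1}^n → {±1}`; `ℤˣ` is the two-element set `{1, -1}`. -/
abbrev BoolFun (n : ℕ) : Type := Cube n → ℤˣ

/-- The real number `1` or `-1` that corresponds to a sign. -/
def signVal (s : ℤˣ) : ℝ := ((s : ℤ) : ℝ)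

/-- The character `χ_x(y) = (-1)^(x₁y₁ + ⋯ + xₙyₙ)`. -/
def chi {n : ℕ} (x y : Cube n) : ℝ := ∏ i, if x i && y i then (-1 : ℝ) else 1

/-- The Fourier coefficient `f̂(x) = 2^(-n) ∑_y f(y) χ_x(y)`. -/
noncomputable def fourierCoeff {n : ℕ} (f : BoolFun n) (x : Cube n) : ℝ :=
  (∑ y, signVal (f y) * chi x y) / 2 ^ n

theorem signVal_sq (s : ℤˣ) : signVal s * signVal s = 1 := by
  rcases Int.units_eq_one_or s with h | h <;> simp [signVal, h]

theorem sum_chi_mul_chi {n : ℕ} (y z : Cube n) :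
    ∑ x : Cube n, chi x y * chi x z = if y = z then (2 : ℝ) ^ n else 0 := by
  have h1 : ∀ x : Cube n, chi x y * chi x z =
      ∏ i, ((if x i && y i then (-1 : ℝ) else 1) * (if x i && z i then (-1 : ℝ) else 1)) := by
    intro x
    simp only [chi, Finset.prod_mul_distrib]
  simp only [h1]
  rw [← Fintype.prod_sum (fun (i : Fin n) (b : Bool) =>
    ((if b && y i then (-1 : ℝ) else 1) * (if b && z i then (-1 : ℝ) else 1)))]
  split_ifs with h
  · subst h
    rw [Finset.prod_congr rfl (g := fun _ => (2 : ℝ))]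
    · simp
    · intro i _
      cases y i <;> norm_num
  · obtain ⟨i, hi⟩ := Function.ne_iff.mp h
    refine Finset.prod_eq_zero (Finset.mem_univ i) ?_
    revert hi
    cases y i <;> cases z i <;> norm_num

/-- Parseval's identity for `{±1}`-valued functions. -/
theorem sum_fourierCoeff_sq {n : ℕ} (f : BoolFun n) : ∑ x, fourierCoeff f x ^ 2 = 1 := by
  have h1 : ∀ x : Cube n, fourierCoeff f x ^ 2 = (∑ y, ∑ z,
      signVal (f y) * signVal (f z) * (chi x y * chi x z)) / (2 ^ n * 2 ^ n) := by
    intro x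
    rw [fourierCoeff, sq, div_mul_div_comm, Finset.sum_mul_sum]
    congr 1
    refine Finset.sum_congr rfl fun y _ => Finset.sum_congr rfl fun z _ => by ring
  simp only [h1]
  rw [← Finset.sum_div, Finset.sum_comm]
  have h2 : ∀ y : Cube n, ∑ x : Cube n, ∑ z, signVal (f y) * signVal (f z) * (chi x y * chi x z)
      = 2 ^ n := by
    intro y
    rw [Finset.sum_comm]
    simp only [← Finset.mul_sum, sum_chi_mul_chi]
    simp [signVal_sq]
  simp only [h2]
  simp

/-- The Fourier distribution `C_f`: it outputs `x` with probability `f̂(x)²`. -/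
noncomputable def fourierDist {n : ℕ} (f : BoolFun n) : PMF (Cube n) :=
  PMF.ofFintype (fun x => ENNReal.ofReal (fourierCoeff f x ^ 2)) (by
    rw [← ENNReal.ofReal_sum_of_nonneg fun x _ => sq_nonneg _, sum_fourierCoeff_sq,
      ENNReal.ofReal_one])

/-! ### The distribution `D` on pairs of Boolean functions -/

/-- The variance parameter `ε = 1 / (C ln N)` with `N = 2^n`. -/
noncomputable def eps (C : ℝ) (n : ℕ) : ℝ := 1 / (C * Real.log (2 ^ n))

/-- The normalized Hadamard matrix `H_N`, with entries `±1 / √N`. -/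
noncomputable def hadamard (n : ℕ) : Matrix (Cube n) (Cube n) ℝ :=
  Matrix.of fun x y => chi x y / Real.sqrt (2 ^ n)

/-- The law of a vector of `N` independent `𝒩(0, ε)` variables (variance `ε`). -/
noncomputable def gaussVec (C : ℝ) (n : ℕ) : Measure (Cube n → ℝ) :=
  Measure.pi fun _ => gaussianReal 0 (Real.toNNReal (eps C n))

/-- The law `G'` of `(X, Y² - ε)`, where `X` is a vector of independent `𝒩(0, ε)` variables,
`Y = H_N X`, and the square is taken coordinatewise. -/
noncomputable def gaussPair (C : ℝ) (n : ℕ) : Measure ((Cube n → ℝ) × (Cube n → ℝ)) :=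
  (gaussVec C n).map fun X => (X, fun i => ((hadamard n).mulVec X i) ^ 2 - eps C n)

/-- Truncation to the interval `[-1, 1]`. -/
noncomputable def trnc (a : ℝ) : ℝ := min 1 (max (-1) a)

theorem trnc_bounds (a : ℝ) : -1 ≤ trnc a ∧ trnc a ≤ 1 :=
  ⟨le_min (by norm_num) (le_max_left _ _), min_le_left _ _⟩

theorem trnc_neg (a : ℝ) : trnc (-a) = - trnc a := by
  unfold trnc
  rcases le_total a 1 with h | h <;> rcases le_total (-1) a with h' | h'
  · rw [max_eq_right h', min_eq_right h, max_eq_right (by linarith), min_eq_right (by linarith)]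
  · rw [max_eq_left h', max_eq_right (by linarith), min_eq_left (by linarith), min_eq_right] <;>
      norm_num
  · rw [max_eq_right h', min_eq_left h, max_eq_left (by linarith), min_eq_right (by linarith)]
  · linarith

/-- Randomized rounding of a real number `a`: the outcome is `1` with probability
`(1 + trnc a) / 2` and `-1` with probability `(1 - trnc a) / 2`. -/
noncomputable def roundSign (a : ℝ) : PMF ℤˣ :=
  PMF.ofFintype (fun s => ENNReal.ofReal ((1 + signVal s * trnc a) / 2)) (by
    have h := trnc_bounds a
    rw [UnitsInt.univ, Finset.sum_insert (by decide), Finset.sum_singleton,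
      ← ENNReal.ofReal_add]
    · simp only [signVal, Units.val_one, Units.val_neg, Int.cast_one, Int.cast_neg]
      rw [← ENNReal.ofReal_one]
      congr 1
      ring
    · simp [signVal]; linarith
    · simp [signVal]; linarith)

theorem measurable_round (s : ℤˣ) : Measurable fun a : ℝ => roundSign a s := by
  have : (fun a : ℝ => roundSign a s) =
      fun a => ENNReal.ofReal ((1 + signVal s * min 1 (max (-1) a)) / 2) := rfl
  rw [this]
  fun_prop

theorem round_neg (a : ℝ) (s : ℤˣ) : roundSign (-a) s = roundSign a (-s) := by
  simp only [roundSign, PMF.ofFintype_apply, trnc_neg, signVal, Units.val_neg, Int.cast_neg]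
  congr 1
  ring

theorem sum_round (a : ℝ) : ∑ s, roundSign a s = 1 := by
  rw [← tsum_fintype (L := .unconditional _), (roundSign a).tsum_coe]

theorem measurable_gaussPair_map (C : ℝ) (n : ℕ) :
    Measurable fun X : Cube n → ℝ =>
      (X, fun i => ((hadamard n).mulVec X i) ^ 2 - eps C n) := by
  unfold Matrix.mulVec dotProduct
  fun_prop

instance (C : ℝ) (n : ℕ) : IsProbabilityMeasure (gaussVec C n) := by
  unfold gaussVec; infer_instance

instance (C : ℝ) (n : ℕ) : IsProbabilityMeasure (gaussPair C n) :=
  Measure.isProbabilityMeasure_map (measurable_gaussPair_map C n).aemeasurable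

theorem sum_prod_round {n : ℕ} (z : Cube n → ℝ) : ∑ g : BoolFun n, ∏ i, roundSign (z i) (g i) = 1 := by
  rw [← Fintype.prod_sum (fun i s => roundSign (z i) s)]
  simp only [sum_round, Finset.prod_const_one]

/-- The probability that `D` outputs `(f, g)`: draw `z = (z₁, z₂)` from `G'`, and round all
coordinates independently; those of `z₁` give `f` and those of `z₂` give `g`. -/
noncomputable def pairProb (C : ℝ) (n : ℕ) (p : BoolFun n × BoolFun n) : ℝ≥0∞ :=
  ∫⁻ z, (∏ i, roundSign (z.1 i) (p.1 i)) * ∏ i, roundSign (z.2 i) (p.2 i) ∂gaussPair C n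

theorem measurable_prod_round {n : ℕ} (g : BoolFun n) :
    Measurable fun z : Cube n → ℝ => ∏ i, roundSign (z i) (g i) :=
  Finset.measurable_fun_prod _ fun i _ => (measurable_round (g i)).comp (measurable_pi_apply i)

theorem measurable_prod_round_fst {n : ℕ} (f : BoolFun n) :
    Measurable fun z : (Cube n → ℝ) × (Cube n → ℝ) => ∏ i, roundSign (z.1 i) (f i) :=
  (measurable_prod_round f).comp measurable_fst

theorem measurable_prod_round_snd {n : ℕ} (g : BoolFun n) :
    Measurable fun z : (Cube n → ℝ) × (Cube n → ℝ) => ∏ i, roundSign (z.2 i) (g i) :=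
  (measurable_prod_round g).comp measurable_snd

theorem sum_pairProb_right (C : ℝ) (n : ℕ) (f : BoolFun n) :
    ∑ g, pairProb C n (f, g) = ∫⁻ z, ∏ i, roundSign (z.1 i) (f i) ∂gaussPair C n := by
  unfold pairProb
  rw [← lintegral_finsetSum _ fun g _ =>
    (measurable_prod_round_fst f).fun_mul (measurable_prod_round_snd g)]
  simp only [← Finset.mul_sum, sum_prod_round, mul_one]

theorem sum_pairProb (C : ℝ) (n : ℕ) : ∑ p, pairProb C n p = 1 := by
  rw [Fintype.sum_prod_type]
  simp only [sum_pairProb_right]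
  rw [← lintegral_finsetSum _ fun f _ => measurable_prod_round_fst f]
  simp [sum_prod_round]

/-- The distribution `D` on pairs `(f, g)` of Boolean functions. -/
noncomputable def pairDist (C : ℝ) (n : ℕ) : PMF (BoolFun n × BoolFun n) :=
  PMF.ofFintype (pairProb C n) (sum_pairProb C n)

theorem lintegral_round (v : ℝ≥0) (s : ℤˣ) :
    ∫⁻ a, roundSign a s ∂gaussianReal 0 v = 1 / 2 := by
  have h1 : ∀ s : ℤˣ, ∫⁻ a, roundSign a (-s) ∂gaussianReal 0 v = ∫⁻ a, roundSign a s ∂gaussianReal 0 v := by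
    intro s
    have h := gaussianReal_map_neg (μ := 0) (v := v)
    rw [neg_zero] at h
    conv_rhs => rw [← h, lintegral_map (measurable_round s) measurable_neg]
    simp only [round_neg]
  have h2 : ∑ s : ℤˣ, ∫⁻ a, roundSign a s ∂gaussianReal 0 v = 1 := by
    rw [← lintegral_finsetSum _ fun s _ => measurable_round s]
    simp only [sum_round, lintegral_one, measure_univ]
  rw [UnitsInt.univ, Finset.sum_insert (by decide), Finset.sum_singleton, h1 1, ← two_mul] at h2
  have h3 : ∫⁻ a, roundSign a s ∂gaussianReal 0 v = ∫⁻ a, roundSign a 1 ∂gaussianReal 0 v := by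
    rcases Int.units_eq_one_or s with h | h
    · rw [h]
    · rw [h, h1 1]
  rw [h3, ENNReal.eq_div_iff (by norm_num) (by norm_num), h2]

/-- The first component of a pair drawn from `D` is a uniformly random Boolean function. -/
theorem sum_pairDist_right (C : ℝ) (n : ℕ) (f : BoolFun n) :
    ∑ g, pairDist C n (f, g) = (1 / 2) ^ (2 ^ n) := by
  have h0 : ∑ g, pairDist C n (f, g) = ∑ g, pairProb C n (f, g) := rfl
  rw [h0, sum_pairProb_right, gaussPair,
    lintegral_map (measurable_prod_round_fst f) (measurable_gaussPair_map C n)]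
  simp only [gaussVec]
  have hind := iIndepFun_pi (μ := fun _ : Cube n => gaussianReal 0 (Real.toNNReal (eps C n)))
    (X := fun i a => roundSign a (f i)) (fun i => (measurable_round (f i)).aemeasurable)
  rw [lintegral_prod_eq_prod_lintegral_of_indepFun Finset.univ
    (fun i (X : Cube n → ℝ) => roundSign (X i) (f i)) hind
    (fun i => (measurable_round (f i)).comp (measurable_pi_apply i))]
  have h1 : ∀ i : Cube n, ∫⁻ X, roundSign (X i) (f i)
      ∂(Measure.pi fun _ : Cube n => gaussianReal 0 (Real.toNNReal (eps C n))) = 1 / 2 := by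
    intro i
    rw [← lintegral_round (Real.toNNReal (eps C n)) (f i)]
    exact (measurePreserving_eval
      (fun _ : Cube n => gaussianReal 0 (Real.toNNReal (eps C n))) i).lintegral_comp
      (measurable_round (f i))
  simp [h1]

theorem exists_mem_support (C : ℝ) (n : ℕ) (f : BoolFun n) :
    ∃ p ∈ {p : BoolFun n × BoolFun n | p.1 = f}, p ∈ (pairDist C n).support := by
  by_contra! h
  have h1 : ∑ g, pairDist C n (f, g) = 0 :=
    Finset.sum_eq_zero fun g _ => by
      have := h (f, g) rfl
      rwa [PMF.mem_support_iff, not_not] at this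
  rw [sum_pairDist_right] at h1
  exact pow_ne_zero _ (by simp) h1

/-- The distribution `D_f`: the law of `g` when `(f', g)` is drawn from `D` conditioned on
`f' = f`. -/
noncomputable def condDist (C : ℝ) {n : ℕ} (f : BoolFun n) : PMF (BoolFun n) :=
  ((pairDist C n).filter {p | p.1 = f} (exists_mem_support C n f)).map Prod.snd

/-! ### Rejection sampling and the RHOG score -/

/-- Rejection sampling on `g` with at most `k` attempts: each attempt draws a fresh uniform `x` and
outputs it if `g(x) = 1`; if all `k` attempts fail, the output is uniformly random. -/
noncomputable def rejectionSample {n : ℕ} (g : BoolFun n) : ℕ → PMF (Cube n)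
  | 0 => PMF.uniformOfFintype (Cube n)
  | k + 1 => (PMF.uniformOfFintype (Cube n)).bind fun x =>
      if g x = 1 then PMF.pure x else rejectionSample g k

/-- The sampler `R_f`: draw `g` from `D_f`, then run rejection sampling on `g` with `4n²`
attempts. -/
noncomputable def rejectionDist (C : ℝ) {n : ℕ} (f : BoolFun n) : PMF (Cube n) :=
  (condDist C f).bind fun g => rejectionSample g (4 * n ^ 2)

/-- The RHOG score `E_{f, s ∼ S_f} [Pr[R_f samples s]]` of a randomized sampler `S`, where `f` is a
uniformly random Boolean function on `{0,1}^n`. -/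
noncomputable def rhogScore (C : ℝ) {n : ℕ} (S : BoolFun n → PMF (Cube n)) : ℝ :=
  (∑ f : BoolFun n, ∑ s, (S f s).toReal * (rejectionDist C f s).toReal) /
    Fintype.card (BoolFun n)

/-- A family of samplers solves RHOG if its score is at least `b / N` for all large `n`, where
`b = 1 + 1/poly(n)`. -/
def SolvesRHOG (C : ℝ) (S : (n : ℕ) → BoolFun n → PMF (Cube n)) : Prop :=
  ∃ c : ℝ, 0 < c ∧ ∃ k : ℕ, ∀ᶠ n : ℕ in atTop,
    (1 + c * (1 / (n : ℝ)) ^ k) / 2 ^ n ≤ rhogScore C (S n)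

end RHOG

namespace RHOG

/-! ### Moments of real Gaussians -/

/-! Since the first marginal of D is uniform, averaging over f and then over D_f is averaging over
D, so N times the score is the D-expectation of N ∑ₛ f̂(s)² Pr[rejection on g gives s]. Write t for
the mean of g and W = ∑ₛ f̂(s)² g(s). Ideal rejection sampling gives (1+W)/(1+t). The capped version
is at least 1 + W - l - t²/l minus an exponentially small term, for any l > 0
(`fourier_rejection_lower_bound`), so only E[W] and E[t²] matter.

Given X, with z = Y² - ε, the rounding is averaged out exactly (`sum_signWeight_lower_bound`): E[W |
X] is the mean over s of (H trnc X)ₛ² trnc(zₛ), plus (1-T)M, where T and M are the means of trnc(X)²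
and trnc(z). H is orthogonal, so Y has the law of X. If truncation is ignored, the main term is E[Y⁴
- εY²] = 3ε² - ε² = 2ε².

All truncation errors are dominated by twelfth powers, and the twelfth Gaussian moment is Kε⁶. The
largest loss, ε⁻²·Kε⁶, is still o(ε²), so no tail estimates are needed. M has mean O(ε⁶) and
variance at most 1/N. With l = ε³ everything lost is o(ε²), which leaves room above ε²/8. -/

theorem integrable_pow_gaussianReal (μ : ℝ) (v : ℝ≥0) (k : ℕ) :
    Integrable (fun x : ℝ => x ^ k) (gaussianReal μ v) := by
  rcases Nat.eq_zero_or_pos k with rfl | hk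
  · simp
  · have h := (memLp_id_gaussianReal' (μ := μ) (v := v) k (by simp)).integrable_norm_pow hk.ne'
    refine h.mono' (by fun_prop) (ae_of_all _ fun x => ?_)
    simp

theorem memLp_two_of_abs_le_pow {μ : ℝ} {v : ℝ≥0} {φ : ℝ → ℝ} (hφ : Measurable φ) (k : ℕ)
    (h : ∀ x, |φ x| ≤ 1 + x ^ (2 * k)) : MemLp φ 2 (gaussianReal μ v) := by
  rw [memLp_two_iff_integrable_sq hφ.aestronglyMeasurable]
  refine (((integrable_const 2).add
    ((integrable_pow_gaussianReal μ v (2 * (2 * k))).const_mul 2))).mono'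
    (hφ.pow_const 2).aestronglyMeasurable (ae_of_all _ fun x => ?_)
  have h1 := pow_le_pow_left₀ (abs_nonneg _) (h x) 2
  rw [Real.norm_eq_abs, abs_pow]
  simp only [Pi.add_apply]
  rw [pow_mul' x 2 (2 * k)]
  nlinarith [sq_nonneg (x ^ (2 * k) - 1)]

/-- Scaling by √v. With k = 6 it makes every truncation error a constant times ε⁶. -/
theorem integral_pow_gaussianReal (v : ℝ≥0) (k : ℕ) :
    ∫ x, x ^ (2 * k) ∂gaussianReal 0 v = v ^ k * ∫ x, x ^ (2 * k) ∂gaussianReal 0 1 := by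
  have h := gaussianReal_map_const_mul (μ := 0) (v := 1) (Real.sqrt v)
  have hv : NNReal.mk (Real.sqrt v ^ 2) (sq_nonneg _) * 1 = v := by
    ext; simp
  rw [hv, mul_zero] at h
  rw [← h, integral_map (by fun_prop) (by fun_prop), ← integral_const_mul]
  refine integral_congr_ae (ae_of_all _ fun x => ?_)
  simp only [mul_pow, pow_mul, Real.sq_sqrt v.coe_nonneg]

theorem integral_sq_gaussianReal (v : ℝ≥0) : ∫ x, x ^ 2 ∂gaussianReal 0 v = v := by
  have h := variance_of_integral_eq_zero (X := fun x : ℝ => x) (μ := gaussianReal 0 v)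
    (by fun_prop) (by simp)
  rw [← h, variance_fun_id_gaussianReal]

theorem integral_pow_four_gaussianReal (v : ℝ≥0) :
    ∫ x, x ^ 4 ∂gaussianReal 0 v = 3 * v ^ 2 := by
  have h := integral_pow_gaussianReal v 2
  norm_num at h
  rw [h, mul_comm]
  congr 1
  rw [integral_gaussianReal_eq_integral_smul one_ne_zero]
  simp only [gaussianPDFReal, sub_zero, NNReal.coe_one, smul_eq_mul, mul_one]
  have h1 : ∀ x : ℝ, (√(2 * Real.pi))⁻¹ * Real.exp (-x ^ 2 / 2) * x ^ 4 =
      (√(2 * Real.pi))⁻¹ * (fun y : ℝ => y ^ (4 : ℝ) * Real.exp (-(1 / 2) * y ^ (2 : ℝ))) |x| := by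
    intro x
    have e : |x| ^ (4 : ℝ) = x ^ 4 := by
      rw [show (4 : ℝ) = (4 : ℕ) by norm_num, Real.rpow_natCast]; exact (even_two_mul 2).pow_abs x
    have e' : |x| ^ (2 : ℝ) = x ^ 2 := by
      rw [show (2 : ℝ) = (2 : ℕ) by norm_num, Real.rpow_natCast]; exact sq_abs x
    simp only [e, e']
    rw [show -x ^ 2 / 2 = -(1 / 2) * x ^ 2 by ring]
    ring
  simp only [h1]
  rw [integral_const_mul, integral_comp_abs (f := fun y : ℝ => y ^ (4 : ℝ) *
    Real.exp (-(1 / 2) * y ^ (2 : ℝ))), integral_rpow_mul_exp_neg_mul_rpow (by norm_num)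
    (by norm_num) (by norm_num)]
  have h2 : Real.Gamma ((4 + 1) / 2) = 3 / 4 * √Real.pi := by
    rw [show ((4 : ℝ) + 1) / 2 = 1 / 2 + 1 + 1 by norm_num, Real.Gamma_add_one (by norm_num),
      Real.Gamma_add_one (by norm_num), Real.Gamma_one_half_eq]
    ring
  have h3 : (1 / 2 : ℝ) ^ (-((4 : ℝ) + 1) / 2) = 4 * √2 := by
    rw [one_div, Real.inv_rpow (by norm_num), ← Real.rpow_neg (by norm_num),
      show -(-((4 : ℝ) + 1) / 2) = 2 + 1 / 2 by norm_num, Real.rpow_add (by norm_num),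
      Real.sqrt_eq_rpow]
    norm_num
  rw [h2, h3, Real.sqrt_mul (by norm_num)]
  have : 0 < √Real.pi := Real.sqrt_pos.2 Real.pi_pos
  field_simp

/-! ### Sums of independent variables -/

/-- Second moment = variance + squared mean; independence makes the variances add, and each is
bounded by the raw second moment. -/
theorem integral_sq_sum_pi {ι : Type*} [Fintype ι] {ν : Measure ℝ} [IsProbabilityMeasure ν]
    {φ : ℝ → ℝ} (hφ : MemLp φ 2 ν) (a : ι → ℝ) :
    ∫ X : ι → ℝ, (∑ i, a i * φ (X i)) ^ 2 ∂Measure.pi (fun _ => ν) ≤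
      (∑ i, a i ^ 2) * ∫ x, φ x ^ 2 ∂ν + ((∑ i, a i) * ∫ x, φ x ∂ν) ^ 2 := by
  have hm : ∀ i, MemLp (fun X : ι → ℝ => a i * φ (X i)) 2 (Measure.pi fun _ => ν) := fun i =>
    (hφ.const_mul (a i)).comp_measurePreserving (measurePreserving_eval (fun _ => ν) i)
  have hs : MemLp (fun X : ι → ℝ => ∑ i, a i * φ (X i)) 2 (Measure.pi fun _ => ν) :=
    memLp_finsetSum _ fun i _ => hm i
  have hv := variance_sum_pi (μ := fun _ : ι => ν) (X := fun i x => a i * φ x)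
    fun i => hφ.const_mul (a i)
  have he : ∫ X : ι → ℝ, ∑ i, a i * φ (X i) ∂Measure.pi (fun _ => ν) =
      (∑ i, a i) * ∫ x, φ x ∂ν := by
    rw [integral_finsetSum _ fun i _ => (hm i).integrable (by norm_num), Finset.sum_mul]
    refine Finset.sum_congr rfl fun i _ => ?_
    rw [integral_const_mul, integral_comp_eval (μ := fun _ : ι => ν) hφ.aestronglyMeasurable]
  have h1 : Var[fun X : ι → ℝ => ∑ i, a i * φ (X i); Measure.pi (fun _ => ν)] =
      ∑ i, a i ^ 2 * Var[φ; ν] := by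
    rw [show (fun X : ι → ℝ => ∑ i, a i * φ (X i)) = ∑ i, fun X : ι → ℝ => a i * φ (X i) by
      ext X; simp, hv]
    exact Finset.sum_congr rfl fun i _ => variance_const_mul _ _ _
  rw [variance_eq_sub hs, he, ← Finset.sum_mul] at h1
  simp only [Pi.pow_apply] at h1
  rw [sub_eq_iff_eq_add] at h1
  rw [h1]
  gcongr
  exact variance_le_expectation_sq hφ.aestronglyMeasurable

/-! ### The Hadamard matrix -/

theorem chi_comm {n : ℕ} (x y : Cube n) : chi x y = chi y x := by
  simp only [chi, Bool.and_comm]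

theorem sum_hadamard_mul_hadamard {n : ℕ} (x y : Cube n) :
    ∑ z, hadamard n x z * hadamard n y z = if x = y then 1 else 0 := by
  have h := sum_chi_mul_chi x y
  have h2 : ∀ z, hadamard n x z * hadamard n y z = (chi z x * chi z y) / 2 ^ n := by
    intro z
    rw [hadamard, Matrix.of_apply, Matrix.of_apply, div_mul_div_comm,
      Real.mul_self_sqrt (by positivity), chi_comm x, chi_comm y]
  simp only [h2]
  rw [← Finset.sum_div, h]
  split_ifs <;> simp

/-- The law of a Gaussian vector with independent coordinates of equal variance is invariant under
the Hadamard transform. -/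
theorem measurePreserving_hadamard (n : ℕ) (v : ℝ≥0) :
    MeasurePreserving (fun X : Cube n → ℝ => (hadamard n).mulVec X)
      (Measure.pi fun _ => gaussianReal 0 v) (Measure.pi fun _ => gaussianReal 0 v) := by
  set P : Measure (Cube n → ℝ) := Measure.pi fun _ => gaussianReal 0 v with hP
  have hlaw : ∀ i, P.map (fun X : Cube n → ℝ => X i) = gaussianReal 0 v := fun i =>
    (measurePreserving_eval (fun _ : Cube n => gaussianReal 0 v) i).map_eq
  have hG1 : ∀ i : Cube n, HasGaussianLaw (fun X : Cube n → ℝ => X i) P := fun i =>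
    ⟨by rw [hlaw i]; infer_instance⟩
  have hind : iIndepFun (fun (i : Cube n) (X : Cube n → ℝ) => X i) P :=
    iIndepFun_pi (μ := fun _ : Cube n => gaussianReal 0 v) (X := fun _ x => x)
      fun _ => aemeasurable_id
  have hG := hind.hasGaussianLaw hG1
  have hHG : HasGaussianLaw (fun X : Cube n → ℝ => (hadamard n).mulVec X) P :=
    hG.map_fun (Matrix.toLin' (hadamard n)).toContinuousLinearMap
  have hcov : ∀ i j : Cube n, cov[fun X => X i, fun X => X j; P] = if i = j then (v : ℝ) else 0 := by
    intro i j
    split_ifs with h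
    · subst h
      rw [covariance_self (measurable_pi_apply i).aemeasurable,
        ← variance_id_gaussianReal (μ := 0) (v := v), ← hlaw i,
        variance_id_map (measurable_pi_apply i).aemeasurable]
    · exact (hind.indepFun h).covariance_eq_zero (hG1 i).memLp_two (hG1 j).memLp_two
  -- The covariance matrix is v·HHᵀ = v·I; jointly Gaussian uncorrelated coordinates are then
  -- independent.
  have hcovH : ∀ x y : Cube n, cov[fun X => (hadamard n).mulVec X x,
      fun X => (hadamard n).mulVec X y; P] = if x = y then (v : ℝ) else 0 := by
    intro x y
    simp only [Matrix.mulVec, dotProduct]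
    rw [covariance_fun_sum_fun_sum (fun i => (hG1 i).memLp_two.const_mul _)
      (fun i => (hG1 i).memLp_two.const_mul _)]
    simp only [covariance_const_mul_left, covariance_const_mul_right, hcov, mul_ite, mul_zero,
      Finset.sum_ite_eq, Finset.mem_univ, if_true]
    trans (∑ z, hadamard n x z * hadamard n y z) * v
    · rw [Finset.sum_mul]
      exact Finset.sum_congr rfl fun z _ => by ring
    · rw [sum_hadamard_mul_hadamard, ite_mul, one_mul, zero_mul]
  have hmeas : ∀ x, Measurable fun X : Cube n → ℝ => (hadamard n).mulVec X x := by
    intro x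
    unfold Matrix.mulVec dotProduct
    fun_prop
  have hHind : iIndepFun (fun (x : Cube n) (X : Cube n → ℝ) => (hadamard n).mulVec X x) P :=
    HasGaussianLaw.iIndepFun_of_covariance_eq_zero hHG fun x y hxy => by simp [hcovH, hxy]
  refine ⟨measurable_pi_lambda _ hmeas, ?_⟩
  rw [(iIndepFun_iff_map_fun_eq_pi_map fun x => (hmeas x).aemeasurable).1 hHind, hP]
  congr 1
  funext x
  have hx : HasGaussianLaw (fun X : Cube n → ℝ => (hadamard n).mulVec X x) P := hHG.eval x
  rw [← hP, hx.map_eq_gaussianReal]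
  congr 1
  · simp only [Matrix.mulVec, dotProduct]
    rw [integral_finsetSum _ fun i _ => (hG1 i).integrable.const_mul _]
    refine Finset.sum_eq_zero fun i _ => ?_
    rw [integral_const_mul, hP, integral_comp_eval (μ := fun _ : Cube n => gaussianReal 0 v)
      (f := fun x => x) (by fun_prop)]
    simp
  · rw [← covariance_self (hmeas x).aemeasurable, hcovH]
    simp

/-! ### Real-valued rounding weights -/

/-- The probability that independent rounding of the coordinates of `z` produces `f`. -/
noncomputable def signWeight {n : ℕ} (z : Cube n → ℝ) (f : BoolFun n) : ℝ :=
  ∏ i, (1 + signVal (f i) * trnc (z i)) / 2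

theorem signVal_one : signVal 1 = 1 := by simp [signVal]

theorem signVal_neg_one : signVal (-1) = -1 := by simp [signVal]

theorem abs_signVal (s : ℤˣ) : |signVal s| = 1 := by
  rcases Int.units_eq_one_or s with h | h <;> simp [signVal, h]

theorem roundFactor_bounds (a : ℝ) (s : ℤˣ) :
    0 ≤ (1 + signVal s * trnc a) / 2 ∧ (1 + signVal s * trnc a) / 2 ≤ 1 := by
  have h := trnc_bounds a
  rcases Int.units_eq_one_or s with hs | hs <;> rw [hs]
  · rw [signVal_one]; constructor <;> linarith
  · rw [signVal_neg_one]; constructor <;> linarith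

theorem toReal_prod_roundSign {n : ℕ} (z : Cube n → ℝ) (f : BoolFun n) :
    (∏ i, roundSign (z i) (f i)).toReal = signWeight z f := by
  rw [ENNReal.toReal_prod, signWeight]
  refine Finset.prod_congr rfl fun i _ => ?_
  rw [roundSign, PMF.ofFintype_apply, ENNReal.toReal_ofReal (roundFactor_bounds _ _).1]

theorem signWeight_nonneg {n : ℕ} (z : Cube n → ℝ) (f : BoolFun n) : 0 ≤ signWeight z f :=
  Finset.prod_nonneg fun _ _ => (roundFactor_bounds _ _).1

theorem signWeight_le_one {n : ℕ} (z : Cube n → ℝ) (f : BoolFun n) : signWeight z f ≤ 1 :=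
  Finset.prod_le_one (fun _ _ => (roundFactor_bounds _ _).1) fun _ _ => (roundFactor_bounds _ _).2

theorem measurable_trnc : Measurable trnc := by
  unfold trnc
  fun_prop

theorem measurable_signWeight {n : ℕ} (f : BoolFun n) :
    Measurable fun z : Cube n → ℝ => signWeight z f := by
  have := measurable_trnc
  unfold signWeight
  fun_prop

/-- The rounded signs are independent with means trnc(zᵢ), so the expectation factors. The cases |S|
= 0, 1, 2 supply all the moments needed. -/
theorem sum_signWeight_mul_prod {n : ℕ} (z : Cube n → ℝ) (S : Finset (Cube n)) :
    ∑ f, signWeight z f * ∏ i ∈ S, signVal (f i) = ∏ i ∈ S, trnc (z i) := by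
  classical
  have h1 : ∀ f : BoolFun n, signWeight z f * ∏ i ∈ S, signVal (f i) =
      ∏ i, ((1 + signVal (f i) * trnc (z i)) / 2 * if i ∈ S then signVal (f i) else 1) := by
    intro f
    rw [Finset.prod_mul_distrib, Fintype.prod_ite_mem, signWeight]
  simp only [h1]
  rw [← Fintype.prod_sum (fun i s =>
    (1 + signVal s * trnc (z i)) / 2 * if i ∈ S then signVal s else 1), ← Fintype.prod_ite_mem S]
  refine Finset.prod_congr rfl fun i _ => ?_
  rw [UnitsInt.univ, Finset.sum_insert (by decide), Finset.sum_singleton, signVal_one,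
    signVal_neg_one]
  split_ifs <;> ring

theorem sum_signWeight {n : ℕ} (z : Cube n → ℝ) : ∑ f, signWeight z f = 1 := by
  simpa using sum_signWeight_mul_prod z ∅

theorem sum_signWeight_mul {n : ℕ} (z : Cube n → ℝ) (i : Cube n) :
    ∑ f, signWeight z f * signVal (f i) = trnc (z i) := by
  simpa using sum_signWeight_mul_prod z {i}

theorem sum_signWeight_mul_mul {n : ℕ} (z : Cube n → ℝ) (i j : Cube n) :
    ∑ f, signWeight z f * (signVal (f i) * signVal (f j)) =
      trnc (z i) * trnc (z j) + if i = j then 1 - trnc (z i) ^ 2 else 0 := by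
  split_ifs with h
  · subst h
    simp only [signVal_sq, mul_one, sum_signWeight]
    ring
  · simpa [Finset.prod_pair h] using sum_signWeight_mul_prod z {i, j}

/-- The second moment of a linear form in independently rounded signs. -/
theorem sum_signWeight_mul_sq {n : ℕ} (z a : Cube n → ℝ) :
    ∑ f, signWeight z f * (∑ i, a i * signVal (f i)) ^ 2 =
      (∑ i, a i * trnc (z i)) ^ 2 + ∑ i, a i ^ 2 * (1 - trnc (z i) ^ 2) := by
  have h1 : ∀ f : BoolFun n, signWeight z f * (∑ i, a i * signVal (f i)) ^ 2 =
      ∑ i, ∑ j, a i * a j * (signWeight z f * (signVal (f i) * signVal (f j))) := by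
    intro f
    rw [sq, Finset.sum_mul_sum, Finset.mul_sum]
    refine Finset.sum_congr rfl fun i _ => ?_
    rw [Finset.mul_sum]
    exact Finset.sum_congr rfl fun j _ => by ring
  simp only [h1]
  rw [Finset.sum_comm]
  have h2 : ∀ i, ∑ f : BoolFun n,
      ∑ j, a i * a j * (signWeight z f * (signVal (f i) * signVal (f j))) =
      a i * trnc (z i) * (∑ j, a j * trnc (z j)) + a i ^ 2 * (1 - trnc (z i) ^ 2) := by
    intro i
    rw [Finset.sum_comm]
    simp only [← Finset.mul_sum, sum_signWeight_mul_mul, mul_add, Finset.sum_add_distrib, mul_ite,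
      mul_zero, Finset.sum_ite_eq, Finset.mem_univ, if_true]
    congr 1
    · rw [Finset.mul_sum]
      exact Finset.sum_congr rfl fun j _ => by ring
    · ring
  simp only [h2]
  rw [Finset.sum_add_distrib, ← Finset.sum_mul, sq]

/-! ### The score as a finite sum -/

theorem toReal_pairProb (C : ℝ) (n : ℕ) (p : BoolFun n × BoolFun n) :
    (pairProb C n p).toReal = ∫ X, signWeight X p.1 *
      signWeight (fun i => ((hadamard n).mulVec X i) ^ 2 - eps C n) p.2 ∂gaussVec C n := by
  have hm := (measurable_prod_round_fst p.1).fun_mul (measurable_prod_round_snd p.2)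
  have hm2 := measurable_gaussPair_map C n
  rw [pairProb, gaussPair]
  rw [lintegral_map hm hm2]
  refine (integral_toReal (hm.comp hm2).aemeasurable ?_).symm.trans ?_
  · refine ae_of_all _ fun X => ?_
    exact ENNReal.mul_lt_top (ENNReal.prod_lt_top fun i _ => PMF.apply_lt_top _ _)
      (ENNReal.prod_lt_top fun i _ => PMF.apply_lt_top _ _)
  · simp only [Function.comp_apply, ENNReal.toReal_mul, toReal_prod_roundSign]

/-- The conditioning event has probability 2^(-N) by uniformity of the first marginal. -/
theorem condDist_apply (C : ℝ) {n : ℕ} (f g : BoolFun n) :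
    condDist C f g = pairProb C n (f, g) * 2 ^ 2 ^ n := by
  classical
  have h0 : ∑' p, ({p : BoolFun n × BoolFun n | p.1 = f}.indicator (pairDist C n)) p =
      (1 / 2) ^ (2 ^ n) := by
    rw [tsum_fintype, Fintype.sum_prod_type, Finset.sum_eq_single f]
    · rw [← sum_pairDist_right C n f]
      exact Finset.sum_congr rfl fun g _ => by simp
    · intro b _ hb
      exact Finset.sum_eq_zero fun g _ => by simp [hb]
    · simp
  rw [condDist, PMF.map_apply, tsum_fintype, Finset.sum_eq_single (f, g)]
  · rw [if_pos rfl, PMF.filter_apply, h0, one_div, ENNReal.inv_pow, inv_inv]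
    simp [pairDist]
  · intro p _ hp
    split_ifs with h
    · rw [PMF.filter_apply, Set.indicator_of_notMem, zero_mul]
      intro hp1
      exact hp (Prod.ext hp1 h.symm)
    · rfl
  · simp

/-- The factor 2^N from conditioning cancels the uniform average over f, leaving an expectation over
the joint law D. -/
theorem rhogScore_eq (C : ℝ) {n : ℕ} (S : BoolFun n → PMF (Cube n)) :
    rhogScore C S = ∑ f : BoolFun n, ∑ g : BoolFun n, (pairProb C n (f, g)).toReal *
      ∑ s, (S f s).toReal * (rejectionSample g (4 * n ^ 2) s).toReal := by
  have hcard : (Fintype.card (BoolFun n) : ℝ) = 2 ^ 2 ^ n := by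
    simp [Fintype.card_pi]
  have hR : ∀ (f : BoolFun n) (s : Cube n), (rejectionDist C f s).toReal =
      2 ^ 2 ^ n * ∑ g, (pairProb C n (f, g)).toReal *
        (rejectionSample g (4 * n ^ 2) s).toReal := by
    intro f s
    rw [rejectionDist, PMF.bind_apply, tsum_fintype, ENNReal.toReal_sum, Finset.mul_sum]
    · refine Finset.sum_congr rfl fun g _ => ?_
      rw [condDist_apply, ENNReal.toReal_mul, ENNReal.toReal_mul, ENNReal.toReal_pow,
        ENNReal.toReal_ofNat]
      ring
    · intro g _
      exact ENNReal.mul_ne_top (PMF.apply_ne_top _ _) (PMF.apply_ne_top _ _)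
  rw [rhogScore, hcard, div_eq_iff (by positivity), Finset.sum_mul]
  refine Finset.sum_congr rfl fun f _ => ?_
  simp only [hR, Finset.mul_sum, Finset.sum_mul]
  rw [Finset.sum_comm]
  exact Finset.sum_congr rfl fun g _ => Finset.sum_congr rfl fun s _ => by ring

/-! ### Rejection sampling -/

/-- The average of the values of a Boolean function. -/
noncomputable def avg {n : ℕ} (g : BoolFun n) : ℝ := (∑ x, signVal (g x)) / 2 ^ n

theorem card_cube (n : ℕ) : (Fintype.card (Cube n) : ℝ) = 2 ^ n := by simp

theorem abs_avg_le_one {n : ℕ} (g : BoolFun n) : |avg g| ≤ 1 := by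
  rw [avg, abs_div, abs_of_pos (by positivity : (0 : ℝ) < 2 ^ n), div_le_one (by positivity)]
  refine (Finset.abs_sum_le_sum_abs _ _).trans ?_
  simp [abs_signVal]

/-- First-attempt analysis: s is accepted at once, or the attempt fails, with probability (1 - `avg
g`)/2, and the process restarts. -/
theorem toReal_rejectionSample_succ {n : ℕ} (g : BoolFun n) (k : ℕ) (s : Cube n) :
    (rejectionSample g (k + 1) s).toReal = (1 + signVal (g s)) / 2 / 2 ^ n +
      (1 - avg g) / 2 * (rejectionSample g k s).toReal := by
  classical
  rw [rejectionSample, PMF.bind_apply, tsum_fintype, ENNReal.toReal_sum]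
  · have h : ∀ x : Cube n, (PMF.uniformOfFintype (Cube n) x *
        (if g x = 1 then PMF.pure x else rejectionSample g k) s).toReal =
        (if s = x then (1 + signVal (g x)) / 2 / 2 ^ n else 0) +
          (1 - signVal (g x)) / 2 / 2 ^ n * (rejectionSample g k s).toReal := by
      intro x
      rw [ENNReal.toReal_mul, PMF.uniformOfFintype_apply, ENNReal.toReal_inv,
        ENNReal.toReal_natCast, card_cube]
      rcases Int.units_eq_one_or (g x) with hg | hg
      · rw [if_pos hg, hg, signVal_one, PMF.pure_apply]
        split_ifs <;> simp
      · rw [if_neg (by rw [hg]; decide), hg, signVal_neg_one]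
        norm_num
    simp only [h]
    rw [Finset.sum_add_distrib, Finset.sum_ite_eq, if_pos (Finset.mem_univ _), ← Finset.sum_mul,
      ← Finset.sum_div, ← Finset.sum_div, Finset.sum_sub_distrib]
    congr 2
    rw [avg]
    simp
    field_simp
  · intro x _
    exact ENNReal.mul_ne_top (PMF.apply_ne_top _ _) (PMF.apply_ne_top _ _)

/-- The recursion has fixed point a·2/(1+t), where a = (1+g(s))/(2N); the inequality 2/(1+t) ≥
2(1-t) replaces it by a bound linear in t, valid even near t = -1. The constant 4 makes the case k =
0 trivial. -/
theorem rejectionSample_lower_bound {n : ℕ} (g : BoolFun n) (k : ℕ) (s : Cube n) :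
    (1 + signVal (g s)) / 2 / 2 ^ n * (2 * (1 - avg g) - 4 * (3 / 4) ^ k) ≤
      (rejectionSample g k s).toReal := by
  have hb := abs_le.1 (abs_avg_le_one g)
  have ha : 0 ≤ (1 + signVal (g s)) / 2 / 2 ^ n := by
    have := abs_le.1 (abs_signVal (g s)).le
    have : 0 ≤ 1 + signVal (g s) := by linarith
    positivity
  induction k with
  | zero =>
    refine le_trans (mul_nonpos_of_nonneg_of_nonpos ha ?_) ENNReal.toReal_nonneg
    norm_num
    linarith
  | succ k ih =>
    rw [toReal_rejectionSample_succ]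
    refine le_trans ?_ (add_le_add_right (mul_le_mul_of_nonneg_left ih (by linarith :
      0 ≤ (1 - avg g) / 2)) _)
    set a := (1 + signVal (g s)) / 2 / 2 ^ n
    set t := avg g
    have hd0 : (0 : ℝ) ≤ (3 / 4) ^ k := by positivity
    have hd1 : (3 / 4 : ℝ) ^ k ≤ 1 := pow_le_one₀ (by norm_num) (by norm_num)
    rw [pow_succ]
    set d : ℝ := (3 / 4) ^ k
    -- This is t² + 2td + d, the slack in the induction step after dividing by a. It vanishes at t =
    -- -1, d = 1, so the ratio 3/4 cannot be lowered here.
    have key : 0 ≤ (1 - d) * t ^ 2 + d * (1 + t) ^ 2 :=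
      add_nonneg (mul_nonneg (by linarith) (sq_nonneg _)) (mul_nonneg hd0 (sq_nonneg _))
    nlinarith [mul_nonneg ha key]

theorem fourier_rejection_lower_bound {n : ℕ} (f g : BoolFun n) (k : ℕ) {l : ℝ} (hl : 0 < l) :
    1 - 4 * (3 / 4) ^ k - l + (∑ s, fourierCoeff f s ^ 2 * signVal (g s)) - avg g ^ 2 / l ≤
      2 ^ n * ∑ s, (fourierDist f s).toReal * (rejectionSample g k s).toReal := by
  have hb := abs_le.1 (abs_avg_le_one g)
  set W := ∑ s, fourierCoeff f s ^ 2 * signVal (g s) with hW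
  have hWle : |W| ≤ 1 := by
    rw [← sum_fourierCoeff_sq f]
    refine (Finset.abs_sum_le_sum_abs _ _).trans (Finset.sum_le_sum fun s _ => ?_)
    rw [abs_mul, abs_signVal, mul_one, abs_of_nonneg (sq_nonneg _)]
  have hW' := abs_le.1 hWle
  set d : ℝ := 4 * (3 / 4) ^ k with hd
  have hd0 : 0 ≤ d := by positivity
  have h1 : (1 + W) / 2 * (2 * (1 - avg g) - d) ≤
      2 ^ n * ∑ s, (fourierDist f s).toReal * (rejectionSample g k s).toReal := by
    have e : (1 + W) / 2 = ∑ s, fourierCoeff f s ^ 2 * ((1 + signVal (g s)) / 2) := by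
      trans (∑ s, fourierCoeff f s ^ 2 + W) / 2
      · rw [sum_fourierCoeff_sq]
      · rw [hW, ← Finset.sum_add_distrib, Finset.sum_div]
        exact Finset.sum_congr rfl fun s _ => by ring
    rw [e, Finset.sum_mul, Finset.mul_sum]
    refine Finset.sum_le_sum fun s _ => ?_
    have h2 := mul_le_mul_of_nonneg_left (rejectionSample_lower_bound g k s)
      (by positivity : 0 ≤ 2 ^ n * fourierCoeff f s ^ 2)
    rw [fourierDist, PMF.ofFintype_apply, ENNReal.toReal_ofReal (sq_nonneg _), ← mul_assoc]
    refine le_trans (le_of_eq ?_) h2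
    rw [← hd]
    field_simp
  refine le_trans ?_ h1
  -- AM-GM with a free weight l, so that only the second moment of `avg g` is needed later.
  have h2 : 2 * |avg g| ≤ l + avg g ^ 2 / l := by
    rw [← sub_nonneg]
    have : l + avg g ^ 2 / l - 2 * |avg g| = (l - |avg g|) ^ 2 / l := by
      rw [← sq_abs (avg g)]; field_simp; ring
    rw [this]
    positivity
  have h3 : avg g * (1 + W) ≤ 2 * |avg g| := by
    calc avg g * (1 + W) ≤ |avg g| * (1 + W) :=
          mul_le_mul_of_nonneg_right (le_abs_self _) (by linarith)
      _ ≤ |avg g| * 2 := mul_le_mul_of_nonneg_left (by linarith) (abs_nonneg _)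
      _ = 2 * |avg g| := mul_comm _ _
  nlinarith

/-! ### Truncation errors -/

theorem abs_trnc_le_one (a : ℝ) : |trnc a| ≤ 1 := abs_le.2 (trnc_bounds a)

theorem trnc_eq_self {a : ℝ} (h1 : -1 ≤ a) (h2 : a ≤ 1) : trnc a = a := by
  rw [trnc, max_eq_right h1, min_eq_right h2]

theorem trnc_eq_one {a : ℝ} (h : 1 ≤ a) : trnc a = 1 := by
  rw [trnc, max_eq_right (by linarith), min_eq_left h]

theorem sq_le_pow_twelve {a : ℝ} (h : 1 ≤ a ^ 2) : a ^ 2 ≤ a ^ 12 := by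
  have := pow_le_pow_right₀ h (show 1 ≤ 6 by norm_num)
  rwa [pow_one, ← pow_mul] at this

theorem pow_four_le_pow_twelve {a : ℝ} (h : 1 ≤ a ^ 2) : a ^ 4 ≤ a ^ 12 := by
  have := pow_le_pow_right₀ h (show 2 ≤ 6 by norm_num)
  rwa [← pow_mul, ← pow_mul] at this

/-- The error is zero on [-1, 1] and at most |a| elsewhere, where any higher even power dominates.
The exponent 12 gives ε⁶ in expectation, enough to survive a later division by ε². -/
theorem trnc_sub_self_sq_le (a : ℝ) : (trnc a - a) ^ 2 ≤ a ^ 12 := by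
  by_cases h : a ^ 2 ≤ 1
  · have h' := abs_le.1 (abs_le_one_iff_mul_self_le_one.2 (by nlinarith : a * a ≤ 1))
    rw [trnc_eq_self h'.1 h'.2, sub_self, zero_pow two_ne_zero]
    positivity
  · push Not at h
    refine le_trans ?_ (sq_le_pow_twelve h.le)
    rcases le_total 0 a with h0 | h0
    · have h1 : 1 ≤ a := by nlinarith
      rw [trnc_eq_one h1]; nlinarith
    · have h1 : 1 ≤ -a := by nlinarith
      have := trnc_eq_one h1
      rw [trnc_neg] at this
      have h2 : trnc a = -1 := by linarith
      rw [h2]; nlinarith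

theorem abs_trnc_sq_sub_le {e : ℝ} (he0 : 0 ≤ e) (he1 : e ≤ 1) (y : ℝ) :
    |trnc (y ^ 2 - e) - (y ^ 2 - e)| ≤ y ^ 12 := by
  rcases le_total (y ^ 2 - e) 1 with h | h
  · rw [trnc_eq_self (by nlinarith) h, sub_self, abs_zero]
    positivity
  · refine le_trans ?_ (sq_le_pow_twelve (by linarith : 1 ≤ y ^ 2))
    rw [trnc_eq_one h, abs_of_nonpos (by linarith)]
    linarith

theorem sq_mul_trnc_ge {e : ℝ} (he0 : 0 ≤ e) (he1 : e ≤ 1) (y : ℝ) :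
    y ^ 4 - e * y ^ 2 - y ^ 12 ≤ y ^ 2 * trnc (y ^ 2 - e) := by
  rcases le_total (y ^ 2 - e) 1 with h | h
  · rw [trnc_eq_self (by nlinarith) h]
    have : 0 ≤ y ^ 12 := by positivity
    nlinarith
  · have := pow_four_le_pow_twelve (by linarith : 1 ≤ y ^ 2)
    rw [trnc_eq_one h]
    nlinarith [sq_nonneg y]

/-- Used with y = (HX)ₛ and w = (H(trnc X - X))ₛ. AM-GM with weight e² splits the cross term 2yw so
that both parts are o(e²) in expectation: e²·E[y²] = e³ and e⁻²·E[w²] = O(e⁴). -/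
theorem add_sq_mul_trnc_ge {e : ℝ} (he0 : 0 < e) (he1 : e ≤ 1) (y w : ℝ) :
    y ^ 4 - e * y ^ 2 - y ^ 12 - e ^ 2 * y ^ 2 - (1 + 1 / e ^ 2) * w ^ 2 ≤
      (y + w) ^ 2 * trnc (y ^ 2 - e) := by
  have h1 := sq_mul_trnc_ge he0.le he1 y
  have h2 : |(2 * y * w + w ^ 2) * trnc (y ^ 2 - e)| ≤ 2 * |y| * |w| + w ^ 2 := by
    rw [abs_mul]
    refine (mul_le_of_le_one_right (abs_nonneg _) (abs_trnc_le_one _)).trans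
      ((abs_add_le _ _).trans ?_)
    rw [abs_mul, abs_mul, abs_two, abs_of_nonneg (sq_nonneg w)]
  have h3 : 2 * |y| * |w| ≤ e ^ 2 * y ^ 2 + 1 / e ^ 2 * w ^ 2 := by
    rw [← sub_nonneg, ← sq_abs y, ← sq_abs w]
    have : e ^ 2 * |y| ^ 2 + 1 / e ^ 2 * |w| ^ 2 - 2 * |y| * |w| = (e * |y| - |w| / e) ^ 2 := by
      field_simp
      ring
    rw [this]
    positivity
  have h4 := (abs_le.1 h2).1
  nlinarith

/-! ### Averaging over the rounding -/

theorem hadamard_sq {n : ℕ} (x y : Cube n) : hadamard n x y ^ 2 = 1 / 2 ^ n := by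
  have h : chi x y ^ 2 = 1 := by
    rw [chi, ← Finset.prod_pow]
    exact Finset.prod_eq_one fun i _ => by split_ifs <;> norm_num
  rw [hadamard, Matrix.of_apply, div_pow, h, Real.sq_sqrt (by positivity)]

/-- Squared mean plus variance for f̂(s) = (Hf)ₛ/√N. All entries of H have square 1/N, so the
variance does not depend on s. -/
theorem sum_signWeight_mul_fourierCoeff_sq {n : ℕ} (z : Cube n → ℝ) (s : Cube n) :
    ∑ f, signWeight z f * fourierCoeff f s ^ 2 =
      ((∑ y, hadamard n s y * trnc (z y)) ^ 2 + (1 - (∑ y, trnc (z y) ^ 2) / 2 ^ n)) / 2 ^ n := by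
  have h : ∀ f : BoolFun n, fourierCoeff f s ^ 2 =
      (∑ y, hadamard n s y * signVal (f y)) ^ 2 / 2 ^ n := by
    intro f
    have h1 : ∑ y, hadamard n s y * signVal (f y) = (∑ y, signVal (f y) * chi s y) / √(2 ^ n) := by
      rw [Finset.sum_div]
      refine Finset.sum_congr rfl fun y _ => ?_
      rw [hadamard, Matrix.of_apply]
      ring
    rw [h1, fourierCoeff, div_pow, div_pow, Real.sq_sqrt (by positivity), div_div, sq (2 ^ n : ℝ)]
  simp only [h, ← mul_div_assoc]
  rw [← Finset.sum_div, sum_signWeight_mul_sq]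
  congr 2
  simp only [hadamard_sq]
  rw [← Finset.mul_sum, Finset.sum_sub_distrib]
  simp
  field_simp

theorem sum_signWeight_mul_avg_sq_le {n : ℕ} (z : Cube n → ℝ) :
    ∑ g, signWeight z g * avg g ^ 2 ≤ ((∑ x, 1 / 2 ^ n * trnc (z x)) ^ 2 + 1 / 2 ^ n) := by
  have h : ∀ g : BoolFun n, avg g = ∑ x, 1 / 2 ^ n * signVal (g x) := by
    intro g
    rw [← Finset.mul_sum, avg]
    ring
  simp only [h]
  rw [sum_signWeight_mul_sq]
  gcongr
  calc ∑ i : Cube n, (1 / 2 ^ n : ℝ) ^ 2 * (1 - trnc (z i) ^ 2)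
      ≤ ∑ i : Cube n, (1 / 2 ^ n : ℝ) ^ 2 :=
        Finset.sum_le_sum fun i _ => mul_le_of_le_one_right (by positivity)
          (by linarith [sq_nonneg (trnc (z i))])
    _ = 1 / 2 ^ n := by
        simp
        field_simp

/-- The conditional expectation, given the Gaussian vector, of the lower bound for the score. -/
theorem sum_signWeight_lower_bound {n : ℕ} (X z : Cube n → ℝ) (a : ℝ) {l : ℝ} (hl : 0 < l) :
    a - l - 1 / 2 ^ n / l - 2 * (∑ x, 1 / 2 ^ n * trnc (z x)) ^ 2 / l +
      (∑ s, (∑ y, hadamard n s y * trnc (X y)) ^ 2 * trnc (z s)) / 2 ^ n ≤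
    ∑ f, ∑ g, signWeight X f * signWeight z g *
      (a + (∑ s, fourierCoeff f s ^ 2 * signVal (g s)) - avg g ^ 2 / l) := by
  set M := ∑ x, 1 / 2 ^ n * trnc (z x) with hM
  set T := (∑ y, trnc (X y) ^ 2) / 2 ^ n with hT
  have e1 : ∑ f, ∑ g, signWeight X f * signWeight z g *
      (a + (∑ s, fourierCoeff f s ^ 2 * signVal (g s)) - avg g ^ 2 / l) =
      a + (∑ s, (∑ f, signWeight X f * fourierCoeff f s ^ 2) * trnc (z s)) -
        (∑ g, signWeight z g * avg g ^ 2) / l := by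
    have h1 : ∀ f : BoolFun n, ∑ g, signWeight X f * signWeight z g *
      (a + (∑ s, fourierCoeff f s ^ 2 * signVal (g s)) - avg g ^ 2 / l) =
      signWeight X f * (a + (∑ s, fourierCoeff f s ^ 2 * trnc (z s)) -
        (∑ g, signWeight z g * avg g ^ 2) / l) := by
      intro f
      simp only [mul_assoc]
      rw [← Finset.mul_sum]
      congr 1
      simp only [mul_sub, mul_add]
      rw [Finset.sum_sub_distrib, Finset.sum_add_distrib, ← Finset.sum_mul, sum_signWeight, one_mul]
      congr 1
      · congr 1
        simp only [Finset.mul_sum]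
        rw [Finset.sum_comm]
        refine Finset.sum_congr rfl fun s _ => ?_
        rw [← sum_signWeight_mul z s, Finset.mul_sum]
        exact Finset.sum_congr rfl fun g _ => by ring
      · rw [Finset.sum_div]
        exact Finset.sum_congr rfl fun g _ => by ring
    rw [Finset.sum_congr rfl fun f _ => h1 f]
    simp only [mul_sub, mul_add]
    rw [Finset.sum_sub_distrib, Finset.sum_add_distrib, ← Finset.sum_mul, ← Finset.sum_mul,
      sum_signWeight, one_mul, one_mul]
    congr 2
    simp only [Finset.mul_sum, Finset.sum_mul]
    rw [Finset.sum_comm]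
    exact Finset.sum_congr rfl fun s _ => Finset.sum_congr rfl fun g _ => by ring
  have e2 : ∑ s, (∑ f, signWeight X f * fourierCoeff f s ^ 2) * trnc (z s) =
      (∑ s, (∑ y, hadamard n s y * trnc (X y)) ^ 2 * trnc (z s)) / 2 ^ n + (1 - T) * M := by
    rw [hM, Finset.sum_div, Finset.mul_sum, ← Finset.sum_add_distrib]
    refine Finset.sum_congr rfl fun s _ => ?_
    rw [sum_signWeight_mul_fourierCoeff_sq]
    ring
  have hT0 : 0 ≤ T := div_nonneg (Finset.sum_nonneg fun _ _ => sq_nonneg _) (by positivity)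
  have hT1 : T ≤ 1 := by
    rw [hT, div_le_one (by positivity)]
    calc ∑ y, trnc (X y) ^ 2 ≤ ∑ _y : Cube n, (1 : ℝ) := Finset.sum_le_sum fun y _ => by
          rw [← sq_abs]; exact pow_le_one₀ (abs_nonneg _) (abs_trnc_le_one _)
      _ = 2 ^ n := by simp
  -- The sign of M is unknown and T depends on X, so this term is bounded by |M| and then by AM-GM.
  have h3 : -(M ^ 2 / l + l) ≤ (1 - T) * M := by
    have h4 : |(1 - T) * M| ≤ |M| := by
      rw [abs_mul, abs_of_nonneg (by linarith : 0 ≤ 1 - T)]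
      exact mul_le_of_le_one_left (abs_nonneg _) (by linarith)
    have h5 : M ^ 2 / l + l - |M| = ((l - |M|) ^ 2 + l * |M|) / l := by
      rw [← sq_abs M]; field_simp; ring
    have h6 : 0 ≤ ((l - |M|) ^ 2 + l * |M|) / l := by positivity
    have := (abs_le.1 h4).1
    linarith
  have h7 := div_le_div_of_nonneg_right (sum_signWeight_mul_avg_sq_le z) hl.le
  rw [e1, e2]
  rw [← hM, add_div] at h7
  have h8 : 2 * M ^ 2 / l = M ^ 2 / l + M ^ 2 / l := by ring
  linarith

/-! ### Gaussian expectations -/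

theorem integral_mulVec_pow {n : ℕ} (v : ℝ≥0) (s : Cube n) (k : ℕ) :
    Integrable (fun X => (hadamard n).mulVec X s ^ k) (Measure.pi fun _ => gaussianReal 0 v) ∧
    ∫ X, (hadamard n).mulVec X s ^ k ∂(Measure.pi fun _ => gaussianReal 0 v) =
      ∫ x, x ^ k ∂gaussianReal 0 v := by
  have hmp := (measurePreserving_eval (fun _ : Cube n => gaussianReal 0 v) s).comp
    (measurePreserving_hadamard n v)
  refine ⟨hmp.integrable_comp_of_integrable (integrable_pow_gaussianReal 0 v k), ?_⟩
  conv_rhs => rw [← hmp.map_eq]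
  rw [integral_map hmp.measurable.aemeasurable (by fun_prop)]
  rfl

theorem memLp_sum_pi {ι : Type*} [Fintype ι] {ν : Measure ℝ} [IsProbabilityMeasure ν]
    {φ : ℝ → ℝ} (hφ : MemLp φ 2 ν) (a : ι → ℝ) :
    MemLp (fun X : ι → ℝ => ∑ i, a i * φ (X i)) 2 (Measure.pi fun _ => ν) :=
  memLp_finsetSum _ fun i _ =>
    (hφ.const_mul (a i)).comp_measurePreserving (measurePreserving_eval (fun _ => ν) i)

/-- The `L²` norm of the Hadamard transform of the truncation errors. -/
theorem integral_truncation_error_sq {n : ℕ} (v : ℝ≥0) (s : Cube n) :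
    Integrable (fun X : Cube n → ℝ => (∑ y, hadamard n s y * (trnc (X y) - X y)) ^ 2)
      (Measure.pi fun _ => gaussianReal 0 v) ∧
    ∫ X : Cube n → ℝ, (∑ y, hadamard n s y * (trnc (X y) - X y)) ^ 2
      ∂(Measure.pi fun _ => gaussianReal 0 v) ≤ ∫ x, x ^ 12 ∂gaussianReal 0 v := by
  set φ : ℝ → ℝ := fun x => trnc x - x with hφ
  have hm : Measurable φ := measurable_trnc.sub measurable_id
  have hφ2 : MemLp φ 2 (gaussianReal 0 v) := by
    refine memLp_two_of_abs_le_pow hm 6 fun x => ?_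
    have h1 := trnc_sub_self_sq_le x
    rw [← sq_abs] at h1
    change |trnc x - x| ≤ 1 + x ^ 12
    nlinarith [sq_nonneg (|trnc x - x| - 1), sq_nonneg |trnc x - x|]
  -- Oddness removes the squared-mean term, which for s = 0 would carry the factor (∑ H₀ᵧ)² = N.
  have hmean : ∫ x, φ x ∂gaussianReal 0 v = 0 := by
    have h := gaussianReal_map_neg (μ := 0) (v := v)
    rw [neg_zero] at h
    have h1 : ∫ x, φ x ∂gaussianReal 0 v = -∫ x, φ x ∂gaussianReal 0 v := by
      conv_lhs => rw [← h, integral_map (by fun_prop) hm.aestronglyMeasurable]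
      rw [← integral_neg]
      congr 1
      funext x
      simp only [hφ, trnc_neg]
      ring
    linarith
  refine ⟨(memLp_sum_pi hφ2 _).integrable_sq, ?_⟩
  refine (integral_sq_sum_pi hφ2 _).trans ?_
  rw [hmean, mul_zero]
  have hH := sum_hadamard_mul_hadamard s s
  simp only [if_true, ← sq] at hH
  rw [hH, one_mul, zero_pow two_ne_zero, add_zero]
  exact integral_mono hφ2.integrable_sq (integrable_pow_gaussianReal 0 v 12)
    fun x => trnc_sub_self_sq_le x

/-- The second moment of the average of the truncated squares. -/
theorem integral_avg_trnc_sq {n : ℕ} {v : ℝ≥0} (hv : v ≤ 1) :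
    Integrable (fun X : Cube n → ℝ =>
      (∑ x, 1 / 2 ^ n * trnc ((hadamard n).mulVec X x ^ 2 - v)) ^ 2)
      (Measure.pi fun _ => gaussianReal 0 v) ∧
    ∫ X : Cube n → ℝ, (∑ x, 1 / 2 ^ n * trnc ((hadamard n).mulVec X x ^ 2 - v)) ^ 2
      ∂(Measure.pi fun _ => gaussianReal 0 v) ≤
      1 / 2 ^ n + (∫ x, x ^ 12 ∂gaussianReal 0 v) ^ 2 := by
  set φ : ℝ → ℝ := fun x => trnc (x ^ 2 - v) with hφ
  have hm : Measurable φ := measurable_trnc.comp (by fun_prop)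
  have hφ2 : MemLp φ 2 (gaussianReal 0 v) :=
    MemLp.of_bound hm.aestronglyMeasurable 1 (ae_of_all _ fun x => abs_trnc_le_one _)
  have hmp := measurePreserving_hadamard n v
  have hint := (memLp_sum_pi hφ2 fun _ : Cube n => (1 / 2 ^ n : ℝ)).integrable_sq
  have hsq : Integrable (fun x : ℝ => x ^ 2 - (v : ℝ)) (gaussianReal 0 v) :=
    (integrable_pow_gaussianReal 0 v 2).sub (integrable_const _)
  refine ⟨hmp.integrable_comp_of_integrable hint, ?_⟩
  -- Since x² - v is centred, the mean of its truncation is purely truncation error.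
  have hmean : |∫ x, φ x ∂gaussianReal 0 v| ≤ ∫ x, x ^ 12 ∂gaussianReal 0 v := by
    have h0 : ∫ x, (x ^ 2 - (v : ℝ)) ∂gaussianReal 0 v = 0 := by
      rw [integral_sub (integrable_pow_gaussianReal 0 v 2) (integrable_const _),
        integral_sq_gaussianReal]
      simp
    have h1 : ∫ x, φ x ∂gaussianReal 0 v = ∫ x, (φ x - (x ^ 2 - (v : ℝ))) ∂gaussianReal 0 v := by
      rw [integral_sub (hφ2.integrable (by norm_num)) hsq, h0, sub_zero]
    rw [h1, ← Real.norm_eq_abs]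
    exact norm_integral_le_of_norm_le (integrable_pow_gaussianReal 0 v 12)
      (ae_of_all _ fun x => abs_trnc_sq_sub_le v.coe_nonneg hv x)
  have h2 := integral_sq_sum_pi hφ2 fun _ : Cube n => (1 / 2 ^ n : ℝ)
  rw [← hmp.map_eq, integral_map hmp.measurable.aemeasurable
    (by rw [hmp.map_eq]; exact hint.aestronglyMeasurable)] at h2
  refine h2.trans ?_
  have h3 : ∫ x, φ x ^ 2 ∂gaussianReal 0 v ≤ 1 := by
    have : ∫ x, φ x ^ 2 ∂gaussianReal 0 v ≤ ∫ _, (1 : ℝ) ∂gaussianReal 0 v :=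
      integral_mono hφ2.integrable_sq (integrable_const _) fun x => by
        simp only [hφ]
        rw [← sq_abs]
        exact pow_le_one₀ (abs_nonneg _) (abs_trnc_le_one _)
    simpa using this
  have h4 : ∑ _x : Cube n, (1 / 2 ^ n : ℝ) = 1 := by simp
  have h5 : ∑ _x : Cube n, (1 / 2 ^ n : ℝ) ^ 2 = 1 / 2 ^ n := by simp; field_simp
  rw [h4, h5, one_mul]
  gcongr ?_ + ?_
  · exact mul_le_of_le_one_right (by positivity) h3
  · rw [← sq_abs]
    gcongr

/-- G replaces the truncated main term by its minorant from `add_sq_mul_trnc_ge`, a combination of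
powers of Yₛ and the squared truncation error, whose integrals are known or bounded. -/
theorem integral_lower_bound {n : ℕ} {v : ℝ≥0} (hv0 : 0 < v) (hv : v ≤ 1) (a b : ℝ) (hb : 0 ≤ b) :
    ∃ G : (Cube n → ℝ) → ℝ, Integrable G (Measure.pi fun _ => gaussianReal 0 v) ∧
      (∀ X, G X ≤ a - b * (∑ x, 1 / 2 ^ n * trnc ((hadamard n).mulVec X x ^ 2 - v)) ^ 2 +
        (∑ s, (∑ y, hadamard n s y * trnc (X y)) ^ 2 *
          trnc ((hadamard n).mulVec X s ^ 2 - v)) / 2 ^ n) ∧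
      a - b * (1 / 2 ^ n + (∫ x, x ^ 12 ∂gaussianReal 0 v) ^ 2) + (2 * (v : ℝ) ^ 2 - v ^ 3 -
        (2 + 1 / (v : ℝ) ^ 2) * ∫ x, x ^ 12 ∂gaussianReal 0 v) ≤
        ∫ X, G X ∂(Measure.pi fun _ => gaussianReal 0 v) := by
  have hv0' : (0 : ℝ) < v := hv0
  have hv' : (v : ℝ) ≤ 1 := hv
  set P : Measure (Cube n → ℝ) := Measure.pi fun _ => gaussianReal 0 v with hP
  set Y : Cube n → (Cube n → ℝ) → ℝ := fun s X => (hadamard n).mulVec X s with hY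
  set E : Cube n → (Cube n → ℝ) → ℝ := fun s X => ∑ y, hadamard n s y * (trnc (X y) - X y) with hE
  set M : (Cube n → ℝ) → ℝ := fun X => ∑ x, 1 / 2 ^ n * trnc (Y x X ^ 2 - v) with hM
  set F : Cube n → (Cube n → ℝ) → ℝ := fun s X => Y s X ^ 4 - v * Y s X ^ 2 - Y s X ^ 12 -
    (v : ℝ) ^ 2 * Y s X ^ 2 - (1 + 1 / (v : ℝ) ^ 2) * E s X ^ 2 with hF
  have hYi : ∀ s k, Integrable (fun X => Y s X ^ k) P := fun s k => (integral_mulVec_pow v s k).1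
  have hEi : ∀ s, Integrable (fun X => E s X ^ 2) P := fun s => (integral_truncation_error_sq v s).1
  have hMi : Integrable (fun X => M X ^ 2) P := (integral_avg_trnc_sq hv).1
  have i1 : ∀ s, Integrable (fun X => Y s X ^ 4 - v * Y s X ^ 2) P := fun s =>
    (hYi s 4).sub ((hYi s 2).const_mul _)
  have i2 : ∀ s, Integrable (fun X => Y s X ^ 4 - v * Y s X ^ 2 - Y s X ^ 12) P := fun s =>
    (i1 s).sub (hYi s 12)
  have i3 : ∀ s, Integrable (fun X => Y s X ^ 4 - v * Y s X ^ 2 - Y s X ^ 12 -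
      (v : ℝ) ^ 2 * Y s X ^ 2) P := fun s => (i2 s).sub ((hYi s 2).const_mul _)
  have hFi : ∀ s, Integrable (F s) P := fun s => (i3 s).sub ((hEi s).const_mul _)
  have hFs : Integrable (fun X => (∑ s, F s X) / 2 ^ n) P :=
    (integrable_finsetSum _ fun s _ => hFi s).div_const _
  -- The leading term is 3v² - v·v, and v³ is the AM-GM cost. One twelfth moment comes from Yₛ¹²,
  -- and 1 + 1/v² of them from the squared truncation error.
  have hFint : ∀ s, 2 * (v : ℝ) ^ 2 - v ^ 3 - (2 + 1 / (v : ℝ) ^ 2) * ∫ x, x ^ 12 ∂gaussianReal 0 v ≤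
      ∫ X, F s X ∂P := by
    intro s
    rw [hF]
    simp only
    rw [integral_sub (i3 s) ((hEi s).const_mul _), integral_sub (i2 s) ((hYi s 2).const_mul _),
      integral_sub (i1 s) (hYi s 12), integral_sub (hYi s 4) ((hYi s 2).const_mul _),
      integral_const_mul, integral_const_mul, integral_const_mul, (integral_mulVec_pow v s 4).2,
      (integral_mulVec_pow v s 2).2, (integral_mulVec_pow v s 12).2, integral_sq_gaussianReal,
      integral_pow_four_gaussianReal]
    have := mul_le_mul_of_nonneg_left (integral_truncation_error_sq v s).2
      (by positivity : (0 : ℝ) ≤ 1 + 1 / (v : ℝ) ^ 2)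
    rw [hE, hP]
    linarith
  have iM : Integrable (fun X => a - b * M X ^ 2) P := (integrable_const a).sub (hMi.const_mul b)
  refine ⟨fun X => a - b * M X ^ 2 + (∑ s, F s X) / 2 ^ n, iM.add hFs, fun X => ?_, ?_⟩
  · refine add_le_add le_rfl
      (div_le_div_of_nonneg_right (Finset.sum_le_sum fun s _ => ?_) (by positivity))
    have h := add_sq_mul_trnc_ge hv0' hv' (Y s X) (E s X)
    have he : Y s X + E s X = ∑ y, hadamard n s y * trnc (X y) := by
      simp only [hY, hE, Matrix.mulVec, dotProduct]
      rw [← Finset.sum_add_distrib]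
      exact Finset.sum_congr rfl fun y _ => by ring
    rw [he] at h
    exact h
  · rw [integral_add iM hFs, integral_sub (integrable_const a) (hMi.const_mul b),
      integral_const_mul, integral_div, integral_finsetSum _ fun s _ => hFi s]
    simp only [integral_const, probReal_univ, one_smul]
    gcongr ?_ - ?_ * ?_ + ?_
    · exact (integral_avg_trnc_sq hv).2
    · rw [le_div_iff₀ (by positivity)]
      refine le_trans (le_of_eq ?_) (Finset.sum_le_sum fun s _ => hFint s)
      rw [Finset.sum_const, Finset.card_univ, nsmul_eq_mul, card_cube, mul_comm]

/-- A quantitative lower bound for the score of the Fourier sampler. -/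
theorem rhogScore_lower_bound {C : ℝ} {n : ℕ} (he0 : 0 < eps C n) (he1 : eps C n ≤ 1) {l : ℝ}
    (hl : 0 < l) {K : ℝ} (hK : K = ∫ x, x ^ 12 ∂gaussianReal 0 1) :
    1 - 4 * (3 / 4) ^ (4 * n ^ 2) - 2 * l - 3 * (1 / 2 ^ n / l) - 2 * (K * eps C n ^ 6) ^ 2 / l +
      2 * eps C n ^ 2 - eps C n ^ 3 - (2 * eps C n ^ 2 + 1) * K * eps C n ^ 4 ≤
      2 ^ n * rhogScore C (fun f : BoolFun n => fourierDist f) := by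
  have hve := Real.coe_toNNReal _ he0.le
  set v := Real.toNNReal (eps C n) with hv
  have hv0 : 0 < v := Real.toNNReal_pos.2 he0
  have hv1 : v ≤ 1 := by rw [← NNReal.coe_le_coe, hve]; exact he1
  have h12 := integral_pow_gaussianReal v 6
  norm_num at h12
  rw [← hK] at h12
  set a : ℝ := 1 - 4 * (3 / 4) ^ (4 * n ^ 2) - l with ha
  -- The coefficient 2/l collects M²/l twice: from E[t²]/l and from the bound on (1-T)M.
  obtain ⟨G, hGi, hGle, hGint⟩ := integral_lower_bound (n := n) hv0 hv1
    (a - l - 1 / 2 ^ n / l) (2 / l) (by positivity)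
  set c : BoolFun n → BoolFun n → ℝ := fun f g =>
    a + (∑ s, fourierCoeff f s ^ 2 * signVal (g s)) - avg g ^ 2 / l with hc
  have h1 : ∑ f : BoolFun n, ∑ g : BoolFun n, (pairProb C n (f, g)).toReal * c f g ≤
      2 ^ n * rhogScore C (fun f : BoolFun n => fourierDist f) := by
    rw [rhogScore_eq, Finset.mul_sum]
    refine Finset.sum_le_sum fun f _ => ?_
    rw [Finset.mul_sum]
    refine Finset.sum_le_sum fun g _ => ?_
    have := mul_le_mul_of_nonneg_left (fourier_rejection_lower_bound f g (4 * n ^ 2) hl)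
      (ENNReal.toReal_nonneg : 0 ≤ (pairProb C n (f, g)).toReal)
    exact this.trans_eq (by ring)
  have hwi : ∀ f g : BoolFun n, Integrable (fun X => signWeight X f *
      signWeight (fun i => ((hadamard n).mulVec X i) ^ 2 - eps C n) g * c f g)
      (gaussVec C n) := by
    intro f g
    have hm : Measurable fun X : Cube n → ℝ => signWeight X f *
        signWeight (fun i => ((hadamard n).mulVec X i) ^ 2 - eps C n) g :=
      (measurable_signWeight f).mul
        ((measurable_signWeight g).comp (measurable_gaussPair_map C n).snd)
    refine (Integrable.of_bound hm.aestronglyMeasurable 1 (ae_of_all _ fun X => ?_)).mul_const _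
    rw [Real.norm_of_nonneg (mul_nonneg (signWeight_nonneg _ _) (signWeight_nonneg _ _))]
    exact mul_le_one₀ (signWeight_le_one _ _) (signWeight_nonneg _ _) (signWeight_le_one _ _)
  have h2 : ∑ f : BoolFun n, ∑ g : BoolFun n, (pairProb C n (f, g)).toReal * c f g =
      ∫ X, ∑ f : BoolFun n, ∑ g : BoolFun n, signWeight X f *
        signWeight (fun i => ((hadamard n).mulVec X i) ^ 2 - eps C n) g * c f g ∂gaussVec C n := by
    rw [integral_finsetSum _ fun f _ => integrable_finsetSum _ fun g _ => hwi f g]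
    refine Finset.sum_congr rfl fun f _ => ?_
    rw [integral_finsetSum _ fun g _ => hwi f g]
    refine Finset.sum_congr rfl fun g _ => ?_
    rw [integral_mul_const, toReal_pairProb]
  have h3 : ∫ X, G X ∂gaussVec C n ≤
      ∑ f : BoolFun n, ∑ g : BoolFun n, (pairProb C n (f, g)).toReal * c f g := by
    rw [h2]
    refine integral_mono hGi (integrable_finsetSum _ fun f _ =>
      integrable_finsetSum _ fun g _ => hwi f g) fun X => (hGle X).trans ?_
    rw [hve]
    refine le_trans (le_of_eq ?_) (sum_signWeight_lower_bound X
      (fun i => ((hadamard n).mulVec X i) ^ 2 - eps C n) a hl)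
    ring
  refine le_trans ?_ (hGint.trans (h3.trans h1))
  rw [h12, hve, ha]
  refine le_of_eq ?_
  field_simp
  ring

/-! ### Asymptotics -/

theorem eps_eq (C : ℝ) (n : ℕ) : eps C n = 1 / (C * Real.log 2) * (1 / (n : ℝ)) := by
  rw [eps, Real.log_pow, one_div_mul_one_div]
  ring

theorem tendsto_eps (C : ℝ) : Tendsto (fun n : ℕ => eps C n) atTop (nhds 0) := by
  simp only [eps_eq]
  simpa using tendsto_one_div_atTop_nhds_zero_nat.const_mul (1 / (C * Real.log 2))

theorem tendsto_pow_div_eps_pow (C : ℝ) (k : ℕ) {r : ℝ} (hr0 : 0 ≤ r) (hr1 : r < 1) :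
    Tendsto (fun n : ℕ => r ^ n / eps C n ^ k) atTop (nhds 0) := by
  have h := (tendsto_pow_const_mul_const_pow_of_lt_one k hr0 hr1).const_mul
    ((C * Real.log 2) ^ k)
  rw [mul_zero] at h
  refine h.congr fun n => ?_
  rw [eps_eq, one_div_mul_one_div, one_div_pow, div_div_eq_mul_div, div_one]
  ring

theorem eventually_score_ge {C : ℝ} (hC : 20 ≤ C) : ∀ᶠ n : ℕ in atTop,
    (1 + eps C n ^ 2 / 8) / 2 ^ n ≤ rhogScore C (fun f : BoolFun n => fourierDist f) := by
  set K := ∫ x, x ^ 12 ∂gaussianReal 0 1 with hK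
  -- This is the total error divided by ε², for l = ε³; the summand 3ε combines 2l with the ε³ loss.
  have hlim : Tendsto (fun n : ℕ => 4 * ((3 / 4 : ℝ) ^ n / eps C n ^ 2) + 3 * eps C n +
      3 * ((1 / 2 : ℝ) ^ n / eps C n ^ 5) + 2 * K ^ 2 * eps C n ^ 7 +
      (2 * eps C n ^ 2 + 1) * K * eps C n ^ 2) atTop (nhds 0) := by
    have h := tendsto_eps C
    have h1 := tendsto_pow_div_eps_pow C 2 (r := 3 / 4) (by norm_num) (by norm_num)
    have h2 := tendsto_pow_div_eps_pow C 5 (r := 1 / 2) (by norm_num) (by norm_num)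
    have := ((((h1.const_mul 4).add (h.const_mul 3)).add (h2.const_mul 3)).add
      ((h.pow 7).const_mul (2 * K ^ 2))).add
      (((((h.pow 2).const_mul 2).add_const 1).mul_const K).mul (h.pow 2))
    simpa using this
  filter_upwards [hlim.eventually_lt_const (show (0 : ℝ) < 1 by norm_num),
    (tendsto_eps C).eventually_lt_const (show (0 : ℝ) < 1 by norm_num), eventually_ge_atTop 1]
    with n h1 h2 hn
  -- At n = 0 the logarithm vanishes and `eps` takes the default value 1/0 = 0, so positivity needs
  -- n ≥ 1.
  have hn' : (0 : ℝ) < n := by exact_mod_cast hn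
  have he : 0 < eps C n := by
    rw [eps_eq]
    have := Real.log_pos (show (1 : ℝ) < 2 by norm_num)
    positivity
  -- The choice l = ε³ is o(ε²), while (Kε⁶)²/l = K²ε⁹ and 1/(Nl) remain negligible.
  have h3 := rhogScore_lower_bound he h2.le (pow_pos he 3) hK
  have h4 : (3 / 4 : ℝ) ^ (4 * n ^ 2) ≤ (3 / 4) ^ n :=
    pow_le_pow_of_le_one (by norm_num) (by norm_num) (by nlinarith)
  rw [div_le_iff₀ (by positivity), mul_comm (rhogScore C _)]
  refine le_trans ?_ h3
  have h5 := mul_lt_mul_of_pos_left h1 (pow_pos he 2)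
  set e := eps C n
  have h6 : e ^ 2 * (4 * ((3 / 4 : ℝ) ^ n / e ^ 2) + 3 * e + 3 * ((1 / 2 : ℝ) ^ n / e ^ 5) +
      2 * K ^ 2 * e ^ 7 + (2 * e ^ 2 + 1) * K * e ^ 2) =
      4 * (3 / 4) ^ n + 3 * e ^ 3 + 3 * (1 / 2 ^ n / e ^ 3) + 2 * (K * e ^ 6) ^ 2 / e ^ 3 +
      (2 * e ^ 2 + 1) * K * e ^ 4 := by
    rw [one_div_pow]
    field_simp
  rw [h6] at h5
  nlinarith [pow_pos he 2]

end RHOG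

theorem mainTheorem4 (C : ℝ) (hC : 20 ≤ C) :
    (∃ n₀ : ℕ, ∀ n : ℕ, n₀ ≤ n →
      (1 + RHOG.eps C n ^ 2 / 8) / 2 ^ n ≤
        RHOG.rhogScore C (fun f : RHOG.BoolFun n => RHOG.fourierDist f)) ∧
    RHOG.SolvesRHOG C (fun _ f => RHOG.fourierDist f) := by
  have h := RHOG.eventually_score_ge hC
  -- Since ε = 1/(C n ln 2), the gain ε²/8 is exactly this constant times n⁻².
  refine ⟨eventually_atTop.1 h, (1 / (C * Real.log 2)) ^ 2 / 8, ?_, 2, ?_⟩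
  · have := Real.log_pos (show (1 : ℝ) < 2 by norm_num)
    positivity
  · filter_upwards [h] with n hn
    rw [RHOG.eps_eq, mul_pow] at hn
    rwa [div_mul_eq_mul_div]
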